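/- Let $G=(V,E)$ be a finite simple undirected graph. An edge cover of $G$ is a set $F\subseteq E$ with $\deg_F(v)\ge 1$ for every $v\in V$, where $\deg_F(v)$ is the number of edges of $F$ incident with $v$. An optimal balanced edge cover is an edge cover $F$ minimizing $\sum_{v\in V}\deg_F(v)(\deg_F(v)+1)/2$. A center of $F$ is a vertex $v$ with $\deg_F(v)>1$. A set $C\subseteq V$ is an extended set of centers of $F$ if $C$ contains all centers of $F$ and every connected component of $(V,F)$ contains exactly one vertex of $C$. A levelling with respect to an edge cover $F$ is obtained as follows. Level $1$ is the set of centers of $F$. For $i=1,2,\dots$, level $i+1$ is formed from the vertices not on any of the levels $1,\dots,i$. If $i$ is odd, it consists of all such vertices that share an edge of $F$ with a vertex on level $i$. If $i$ is even, the vertices are examined one after another, in an arbitrary order, and such a vertex $v$ is put on level $i+1$ if it shares an edge of $E\setminus F$ with a vertex on level $i$ and shares no edge of $F$ with a vertex already put on level $i+1$. Some vertices may remain without a level. **Lemma.** Let $F$ be an edge cover of $G$ of minimum cardinality, and take any levelling with respect to $F$. Let $C$ consist of all vertices on odd levels together with exactly one (arbitrarily chosen) endpoint of each edge of $F$ both of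 whose endpoints have no level. Then $C$ is an extended set of centers of some optimal balanced edge cover $F^*$ of $G$. That is, $C$ contains all centers of $F^*$, and each connected component of $(V,F^*)$ has exactly one vertex in $C$. -/

import Mathlib

namespace BalancedEdgeCover

variable {V : Type*}

/-- The degree `deg_F(v)` of `v` in `F`. A set of edges of a simple graph `G` on `V` is represented
by the spanning subgraph `F ≤ G` that has exactly these edges. -/
noncomputable def deg (F : SimpleGraph V) (v : V) : ℕ := (F.neighborSet v).ncard

/-- `F` is an edge cover of `G`: a set of edges of `G` such that every vertex is incident with at
least one of them. -/
def IsEdgeCover (G F : SimpleGraph V) : Prop := F ≤ G ∧ ∀ v, 1 ≤ deg F v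

/-- `F` is an edge cover of `G` with the minimum number of edges. -/
def IsMinimumEdgeCover (G F : SimpleGraph V) : Prop :=
  IsEdgeCover G F ∧ ∀ F', IsEdgeCover G F' → F.edgeSet.ncard ≤ F'.edgeSet.ncard

/-- The balanced cost of `F`: a vertex of degree `d` costs `1 + 2 + ⋯ + d = d (d + 1) / 2`
(the division is exact). -/
noncomputable def cost [Fintype V] (F : SimpleGraph V) : ℕ :=
  ∑ v, deg F v * (deg F v + 1) / 2

/-- `F` is an optimal balanced edge cover of `G`: an edge cover of minimum cost. -/
def IsOptimalBalancedEdgeCover [Fintype V] (G F : SimpleGraph V) : Prop :=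
  IsEdgeCover G F ∧ ∀ F', IsEdgeCover G F' → cost F ≤ cost F'

/-- A center of `F` is a vertex of degree more than one in `F`. -/
def IsCenter (F : SimpleGraph V) (v : V) : Prop := 1 < deg F v

/-- `C` is an extended set of centers of `F`: it contains all centers of `F`, and each connected
component of `F` contains exactly one vertex in `C`. -/
def IsExtendedSetOfCenters (F : SimpleGraph V) (C : Set V) : Prop :=
  (∀ v, IsCenter F v → v ∈ C) ∧ ∀ K : F.ConnectedComponent, ∃! v, v ∈ C ∧ v ∈ K.supp

/-- `L` is a levelling of the vertices of `G` with respect to the edge cover `F`; `L i` is the set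
of vertices on level `i`, for `i ≥ 1` (level `0` is unused).

The process that builds an odd level `i + 1 ≥ 3` looks at the vertices one after another, and its
outcome depends on their order. The sets that can result are exactly the sets `L (i + 1)` that
satisfy `odd_level`: an unassigned vertex `v` with an edge outside `F` to level `i` is on level
`i + 1` if and only if no vertex on level `i + 1` shares an edge of `F` with `v`. Thus of two
such vertices joined by an edge of `F` exactly one, no matter which, is put on level `i + 1`. -/
structure IsLevelling (G F : SimpleGraph V) (L : ℕ → Set V) : Prop where
  level_zero : L 0 = ∅
  level_one : L 1 = {v | IsCenter F v}
  even_level : ∀ i, Odd i →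
    L (i + 1) = {v | (∀ j ≤ i, v ∉ L j) ∧ ∃ u ∈ L i, F.Adj u v}
  odd_level : ∀ i, i ≠ 0 → Even i →
    L (i + 1) = {v | (∀ j ≤ i, v ∉ L j) ∧ (∃ u ∈ L i, G.Adj u v ∧ ¬ F.Adj u v) ∧
      ∀ w ∈ L (i + 1), ¬ F.Adj w v}

/-- The vertices on odd levels. -/
def oddVertices (L : ℕ → Set V) : Set V := {v | ∃ i, Odd i ∧ v ∈ L i}

/-- The vertices that are not assigned to any level. -/
def unlevelled (L : ℕ → Set V) : Set V := {v | ∀ i, v ∉ L i}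

/-- `C` is a set of vertices produced by Find-Center from the minimum edge cover `F` of `G`: for
some levelling `L` with respect to `F`, the set `C` consists of the vertices on odd levels (the
right-hand side of the semi-matching instance that is solved) and one endpoint, chosen
arbitrarily, of each edge of `F` between two vertices without a level (these edges are kept). -/
def IsFindCenterSet (G F : SimpleGraph V) (C : Set V) : Prop :=
  IsMinimumEdgeCover G F ∧ ∃ (L : ℕ → Set V) (T : Set V), IsLevelling G F L ∧
    T ⊆ unlevelled L ∧
    (∀ u ∈ unlevelled L, ∀ v ∈ unlevelled L, F.Adj u v → (u ∈ T ↔ v ∉ T)) ∧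
    C = oddVertices L ∪ T

end BalancedEdgeCover

/-! Let `E` and `O` be the vertices on even and odd levels. No edge of `G` joins `E` to an
unlevelled vertex, and `F` matches the unlevelled vertices among themselves. The cover sought is a
star forest with centers in `C`: it keeps `F` on the unlevelled part and assigns each vertex of `E`
to a neighbour in `O`. Among the assignments that hit all of `O`, take an `f` that minimises the sum
of the squared loads.

Optimality among all edge covers, not only those with centers in `C`, is certified by an integer
potential (`exists_assignment_potential`): `h o` is the largest `k` such that an alternating path
leads from a vertex of load at least `k + 1` to `o`. Minimality of `f` forces `h ≤ load ≤ h + 1`,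
and extending a path by one step gives `h (f e) ≤ h o` for every edge `e o`. If `h (f e) ≥ 2`, then
`e` has no neighbour in `E`: two adjacent vertices could both be freed with all of `O` still hit
(`exists_free_pair`), and the edge between them would complete a cover smaller than `F`.

Hence in any edge cover `F'`, each `e` has a neighbour whose weight `h - 1` (zero off `O`) is at
least that of `f e`. Summing, and using that `F'` has at least `F.edgeSet.ncard` edges, bounds the
sum of the degrees of `F'` weighted by `h + 1` on `O` and 2 elsewhere. These weights are
subgradients of the convex vertex cost at the degrees of the star forest, so `F'` costs at least as
much (`cost_le_of_sum_le`). -/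

namespace BalancedEdgeCover

/-! ### Assignments, alternating paths and loads. -/

section Assignment

open Classical in
/-- The number of elements of `D` that `f` assigns to `o`. -/
noncomputable def load {V : Type*} (D : Finset V) (f : V → V) (o : V) : ℕ :=
  (D.filter fun x => f x = o).card

/-- `f` assigns to every vertex of `D` a neighbour in `O`. -/
def IsAssignment {V : Type*} (G : SimpleGraph V) (D O : Finset V) (f : V → V) : Prop :=
  ∀ x ∈ D, f x ∈ O ∧ G.Adj x (f x)

/-- The vertices of `O` reachable from `A` by at most `n` alternating steps `f b, b, o`. -/
def reachIn {V : Type*} (G : SimpleGraph V) (D O : Finset V) (f : V → V) (A : Set V) :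
    ℕ → Set V
  | 0 => A
  | n + 1 => reachIn G D O f A n ∪ {o | o ∈ O ∧ ∃ b ∈ D, f b ∈ reachIn G D O f A n ∧ G.Adj b o}

/-- The vertices of `O` reachable from `A` by alternating steps `f b, b, o`. -/
def reach {V : Type*} (G : SimpleGraph V) (D O : Finset V) (f : V → V) (A : Set V) : Set V :=
  {o | ∃ n, o ∈ reachIn G D O f A n}

variable {V : Type*} {G : SimpleGraph V} {D O : Finset V} {f : V → V} {A : Set V}

theorem subset_reach : A ⊆ reach G D O f A := fun _ h => ⟨0, h⟩

theorem reach_closed {e o : V} (he : e ∈ D) (h : f e ∈ reach G D O f A) (ho : o ∈ O)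
    (hadj : G.Adj e o) : o ∈ reach G D O f A := by
  obtain ⟨n, hn⟩ := h
  exact ⟨n + 1, Or.inr ⟨ho, e, he, hn, hadj⟩⟩

theorem reach_subset {R : Set V} (hA : A ⊆ R)
    (hR : ∀ e ∈ D, f e ∈ R → ∀ o ∈ O, G.Adj e o → o ∈ R) : reach G D O f A ⊆ R := by
  rintro o ⟨n, hn⟩
  induction n generalizing o with
  | zero => exact hA hn
  | succ n ih =>
    rcases hn with hn | ⟨ho, b, hb, hbn, hadj⟩
    · exact ih hn
    · exact hR b hb (ih hbn) o ho hadj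

open Classical in
theorem load_erase {e : V} (he : e ∈ D) (o : V) :
    load (D.erase e) f o + (if o = f e then 1 else 0) = load D f o := by
  unfold load
  rw [Finset.filter_erase]
  split_ifs with h
  · exact Finset.card_erase_add_one (Finset.mem_filter.2 ⟨he, h.symm⟩)
  · rw [Finset.erase_eq_of_notMem, add_zero]
    simp only [Finset.mem_filter, not_and]
    exact fun _ h' => h h'.symm

theorem load_congr {g : V → V} (h : ∀ x ∈ D, f x = g x) (o : V) : load D f o = load D g o := by
  classical
  unfold load
  congr 1
  exact Finset.filter_congr fun x hx => by rw [h x hx]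

open Classical in
theorem load_update {b : V} (hb : b ∈ D) (o v : V) :
    load D (Function.update f b o) v = load (D.erase b) f v + (if v = o then 1 else 0) := by
  rw [← load_erase hb, Function.update_self]
  congr 1
  refine load_congr (fun x hx => ?_) v
  rw [Function.update_of_ne (Finset.ne_of_mem_erase hx)]

open Classical in
theorem IsAssignment.update {b o : V} (hf : IsAssignment G (D.erase b) O f) (ho : o ∈ O)
    (hadj : G.Adj b o) : IsAssignment G D O (Function.update f b o) := by
  intro x hx
  by_cases hxb : x = b
  · subst hxb
    simpa using ⟨ho, hadj⟩
  · rw [Function.update_of_ne hxb]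
    exact hf x (Finset.mem_erase.2 ⟨hxb, hx⟩)

-- Induction on the length of the path: free its last-but-one vertex `b`, then let `b` replace `e`.
-- The last clause keeps the induction alive: `f e` is not reached in `n` steps, so the shift that
-- frees `b` leaves `e` where it was.
open Classical in
theorem exists_shift_aux (hf : IsAssignment G D O f) (n : ℕ) {e : V} (he : e ∈ D)
    (hr : f e ∈ reachIn G D O f A n) :
    ∃ f', ∃ a ∈ A, IsAssignment G (D.erase e) O f' ∧
      (∀ o, load (D.erase e) f' o + (if o = a then 1 else 0) = load D f o) ∧
      ∀ x ∈ D, f x ∉ reachIn G D O f A n → f' x = f x := by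
  induction n generalizing e with
  | zero =>
    exact ⟨f, f e, hr, fun x hx => hf x (Finset.mem_of_mem_erase hx), fun o => load_erase he o,
      fun _ _ _ => rfl⟩
  | succ n ih =>
    by_cases hen : f e ∈ reachIn G D O f A n
    · obtain ⟨f', a, ha, h1, h2, h3⟩ := ih he hen
      exact ⟨f', a, ha, h1, h2, fun x hx hxn => h3 x hx fun h => hxn (Or.inl h)⟩
    · rcases hr with hr | ⟨ho, b, hb, hbn, hadj⟩
      · exact absurd hr hen
      obtain ⟨f', a, ha, h1, h2, h3⟩ := ih hb hbn
      have hne : ∀ x, f x ∉ reachIn G D O f A n → x ≠ b := by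
        rintro x hx rfl
        exact hx hbn
      have h4 := h1.update ho hadj
      -- `b` takes the place that `e` vacates, so the load of `f e` is unaffected by the exchange.
      refine ⟨Function.update f' b (f e), a, ha, fun x hx => h4 x (Finset.mem_of_mem_erase hx),
        fun o => ?_, fun x hx hxn => ?_⟩
      · have h5 := load_erase (f := Function.update f' b (f e)) he o
        rw [load_update hb, Function.update_of_ne (hne e hen), h3 e he hen] at h5
        rw [← h2 o, Nat.add_right_cancel h5]
      · have hxn' : f x ∉ reachIn G D O f A n := fun h => hxn (Or.inl h)
        rw [Function.update_of_ne (hne x hxn'), h3 x hx hxn']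

open Classical in
/-- Along an alternating path from `A` to `f e`, an assignment can be shifted so that `e` becomes
free and only the load of the start of the path drops. -/
theorem exists_shift (hf : IsAssignment G D O f) {e : V} (he : e ∈ D)
    (hr : f e ∈ reach G D O f A) :
    ∃ f', ∃ a ∈ A, IsAssignment G (D.erase e) O f' ∧
      (∀ o, load (D.erase e) f' o + (if o = a then 1 else 0) = load D f o) ∧
      ∀ x ∈ D, f x ∉ reach G D O f A → f' x = f x := by
  obtain ⟨n, hn⟩ := hr
  obtain ⟨f', a, ha, h1, h2, h3⟩ := exists_shift_aux hf n he hn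
  exact ⟨f', a, ha, h1, h2, fun x hx hxn => h3 x hx fun h => hxn ⟨n, h⟩⟩

open Classical in
theorem card_filter_mem_eq_sum_load (Q : Finset V) :
    (D.filter fun x => f x ∈ Q).card = ∑ o ∈ Q, load D f o := by
  rw [Finset.card_eq_sum_card_fiberwise (s := D.filter fun x => f x ∈ Q) (f := f) (t := Q)
    fun x hx => (Finset.mem_filter.1 hx).2]
  refine Finset.sum_congr rfl fun o ho => ?_
  unfold load
  congr 1
  ext x
  simp only [Finset.mem_filter]
  constructor
  · rintro ⟨⟨h1, -⟩, h2⟩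
    exact ⟨h1, h2⟩
  · rintro ⟨h1, rfl⟩
    exact ⟨⟨h1, ho⟩, rfl⟩

/-- If every nonempty `Q ⊆ O` contains a vertex of `φ`-load at least two or can be entered by an
alternating step of `φ`, then a set closed under the alternating steps of `f` that contains all
vertices of `f`-load at least two is everything. -/
theorem mem_of_closed {φ : V → V} (hφ : IsAssignment G D O φ)
    (hφ1 : ∀ o ∈ O, 1 ≤ load D φ o)
    (hacc : ∀ Q ⊆ O, Q.Nonempty →
      (∃ o ∈ Q, 2 ≤ load D φ o) ∨ ∃ e ∈ D, φ e ∉ Q ∧ ∃ o ∈ Q, G.Adj e o)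
    (hf : IsAssignment G D O f) {R : Set V}
    (hR2 : ∀ o ∈ O, 2 ≤ load D f o → o ∈ R)
    (hR : ∀ e ∈ D, f e ∈ R → ∀ o ∈ O, G.Adj e o → o ∈ R) : ∀ o ∈ O, o ∈ R := by
  classical
  by_contra! hne
  obtain ⟨o₀, ho₀, ho₀R⟩ := hne
  set Q := O.filter fun o => o ∉ R with hQ
  have memQ : ∀ o, o ∈ Q ↔ o ∈ O ∧ o ∉ R := fun o => Finset.mem_filter
  have hQO : Q ⊆ O := Finset.filter_subset _ _
  -- If `f x` were in `R`, the step from `x` to `φ x` would put `φ x` in `R`, outside `Q`.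
  have hsub : (D.filter fun x => φ x ∈ Q) ⊆ D.filter fun x => f x ∈ Q := by
    intro x hx
    rw [Finset.mem_filter, memQ] at hx ⊢
    exact ⟨hx.1, (hf x hx.1).1, fun h => hx.2.2 (hR x hx.1 h _ hx.2.1 (hφ x hx.1).2)⟩
  have hle : ∑ o ∈ Q, load D f o ≤ Q.card := by
    rw [Finset.card_eq_sum_ones]
    refine Finset.sum_le_sum fun o ho => ?_
    by_contra! h
    exact ((memQ o).1 ho).2 (hR2 o (hQO ho) h)
  rw [← card_filter_mem_eq_sum_load] at hle
  rcases hacc Q hQO ⟨o₀, (memQ o₀).2 ⟨ho₀, ho₀R⟩⟩ with ⟨o, ho, h2⟩ | ⟨e, he, heQ, o, ho, hadj⟩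
  · have hlt : Q.card < ∑ o ∈ Q, load D φ o := by
      rw [Finset.card_eq_sum_ones]
      exact Finset.sum_lt_sum (fun o ho => hφ1 o (hQO ho)) ⟨o, ho, h2⟩
    rw [← card_filter_mem_eq_sum_load] at hlt
    exact absurd (Finset.card_le_card hsub) (by omega)
  · have hge : Q.card ≤ ∑ o ∈ Q, load D φ o := by
      rw [Finset.card_eq_sum_ones]
      exact Finset.sum_le_sum fun o ho => hφ1 o (hQO ho)
    rw [← card_filter_mem_eq_sum_load] at hge
    -- Under `f` at most `Q.card` vertices go to `Q`, under `φ` at least that many, so both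
    -- preimages coincide. Then `f e` lies in `R`, and the step from `e` into `Q` contradicts
    -- closedness.
    have heq := Finset.eq_of_subset_of_card_le hsub (hle.trans hge)
    have hefR : f e ∈ R := by
      by_contra h
      have : e ∈ D.filter fun x => f x ∈ Q :=
        Finset.mem_filter.2 ⟨he, (memQ _).2 ⟨(hf e he).1, h⟩⟩
      rw [← heq] at this
      exact heQ (Finset.mem_filter.1 this).2
    exact ((memQ o).1 ho).2 (hR e he hefR o (hQO ho) hadj)

-- Moving one unit from `a` to `b` changes the sum by `2 (x b - x a + 1)`, which is at most `-2`.
open Classical in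
theorem sum_sq_lt {x y : V → ℕ} {a b : V} (ha : a ∈ O) (hb : b ∈ O)
    (hab : x b + 2 ≤ x a)
    (h : ∀ o, y o + (if o = a then 1 else 0) = x o + (if o = b then 1 else 0)) :
    ∑ o ∈ O, y o ^ 2 < ∑ o ∈ O, x o ^ 2 := by
  have hne : a ≠ b := by rintro rfl; omega
  have key : ∀ o, ((y o : ℤ)) ^ 2 = (x o : ℤ) ^ 2 + (if o = b then 2 * (x b : ℤ) + 1 else 0)
      + (if o = a then 1 - 2 * (x a : ℤ) else 0) := by
    intro o
    have ho := h o
    by_cases h1 : o = a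
    · subst h1
      simp only [if_true, if_neg hne] at ho ⊢
      have : (y o : ℤ) = x o - 1 := by omega
      rw [this]; ring
    · by_cases h2 : o = b
      · subst h2
        simp only [if_true, if_neg h1] at ho ⊢
        have : (y o : ℤ) = x o + 1 := by omega
        rw [this]; ring
      · simp only [if_neg h1, if_neg h2] at ho ⊢
        have : (y o : ℤ) = x o := by omega
        rw [this]; ring
  have : (∑ o ∈ O, (y o : ℤ) ^ 2) < ∑ o ∈ O, (x o : ℤ) ^ 2 := by
    simp only [key, Finset.sum_add_distrib, Finset.sum_ite_eq', ha, hb, if_true]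
    have : (x b : ℤ) + 2 ≤ x a := by exact_mod_cast hab
    linarith
  exact_mod_cast this

/-- The loads of a surjective assignment that minimises the sum of their squares drop by at most
one along alternating paths. -/
theorem le_load_of_mem_reach (hf : IsAssignment G D O f) (hf1 : ∀ o ∈ O, 1 ≤ load D f o)
    (hmin : ∀ g, IsAssignment G D O g → (∀ o ∈ O, 1 ≤ load D g o) →
      ∑ o ∈ O, load D f o ^ 2 ≤ ∑ o ∈ O, load D g o ^ 2)
    {k : ℕ} {o : V} (ho : o ∈ reach G D O f {o | o ∈ O ∧ k + 1 ≤ load D f o}) :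
    k ≤ load D f o := by
  classical
  obtain ⟨n, hn⟩ := ho
  induction n generalizing o with
  | zero => exact (Nat.le_succ k).trans hn.2
  | succ n ih =>
    rcases hn with hn | ⟨ho, b, hb, hbn, hadj⟩
    · exact ih hn
    · have hr : f b ∈ reach G D O f {o | o ∈ O ∧ k + 1 ≤ load D f o} := ⟨_, hbn⟩
      obtain ⟨f', a, ha, h1, h2, -⟩ := exists_shift hf hb hr
      by_contra! hlt
      have hl : ∀ v, load D (Function.update f' b o) v + (if v = a then 1 else 0) =
          load D f v + (if v = o then 1 else 0) := fun v => by
        rw [load_update hb, ← h2 v]; omega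
      -- Sending the freed `b` to `o` moves one unit of load from `a`, of load at least `k + 1`, to
      -- `o`, of load below `k`. Since `o` already has load at least one, `a` keeps a positive load.
      refine absurd (hmin _ (h1.update ho hadj) fun v hv => ?_)
        (not_le.2 (sum_sq_lt ha.1 ho (by have := ha.2; omega) hl))
      have := hl v
      have := hf1 v hv
      have := hf1 o ho
      have := ha.2
      by_cases hva : v = a
      · subst hva; simp only [if_true] at *; omega
      · simp only [if_neg hva] at *; omega

end Assignment

/-! ### The optimal assignment and its potential. -/

section Optimal

variable {V : Type*} {G : SimpleGraph V} {D O : Finset V} {f φ : V → V}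

open Classical in
/-- A vertex `e₁` assigned to a vertex reachable from loads at least `k + 1 ≥ 3` can be freed
together with any other vertex `e₂`, without making a load vanish. -/
theorem exists_free_pair (hφ : IsAssignment G D O φ)
    (hφ1 : ∀ o ∈ O, 1 ≤ load D φ o)
    (hacc : ∀ Q ⊆ O, Q.Nonempty →
      (∃ o ∈ Q, 2 ≤ load D φ o) ∨ ∃ e ∈ D, φ e ∉ Q ∧ ∃ o ∈ Q, G.Adj e o)
    (hf : IsAssignment G D O f) (hf1 : ∀ o ∈ O, 1 ≤ load D f o)
    {k : ℕ} (hk : 2 ≤ k)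
    (hload : ∀ o ∈ reach G D O f {o | o ∈ O ∧ k + 1 ≤ load D f o}, k ≤ load D f o)
    {e₁ e₂ : V} (h₁ : e₁ ∈ D) (h₂ : e₂ ∈ D) (hne : e₁ ≠ e₂)
    (hr : f e₁ ∈ reach G D O f {o | o ∈ O ∧ k + 1 ≤ load D f o}) :
    ∃ g, IsAssignment G ((D.erase e₁).erase e₂) O g ∧
      ∀ o ∈ O, 1 ≤ load ((D.erase e₁).erase e₂) g o := by
  set A := {o | o ∈ O ∧ k + 1 ≤ load D f o}
  obtain ⟨f', a, ha, hf', hl, hfix⟩ := exists_shift hf h₁ hr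
  set A' := {o | o ∈ O ∧ 2 ≤ load (D.erase e₁) f' o}
  have haO : a ∈ O := ha.1
  have ha2 : k + 1 ≤ load D f a := ha.2
  -- Only the load of `a` has dropped, from at least `k + 1` to at least `k ≥ 2`.
  have hload2 : ∀ o ∈ O, 2 ≤ load D f o → o ∈ A' := fun o ho h => by
    refine ⟨ho, ?_⟩
    have := hl o
    by_cases hoa : o = a
    · subst hoa; simp only [if_true] at this; omega
    · rw [if_neg hoa] at this; omega
  have hreachO : ∀ o ∈ reach G D O f A, o ∈ O := fun o ho =>
    reach_subset (R := {o | o ∈ O}) (fun o ho => ho.1) (fun _ _ _ o ho _ => ho) ho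
  have hsub : ∀ o ∈ reach G D O f A, o ∈ reach G (D.erase e₁) O f' A' := fun o ho =>
    subset_reach (hload2 o (hreachO o ho) (hk.trans (hload o ho)))
  have hall : ∀ o ∈ O, o ∈ reach G (D.erase e₁) O f' A' := by
    -- The closure argument is run for the old `f` on the set reachable under the new `f'`. Where
    -- the two differ, `f x` is in the old reachable set, whose vertices all have load at least `k ≥
    -- 2` and so are starting points for `f'`.
    refine mem_of_closed hφ hφ1 hacc hf (fun o ho h => subset_reach (hload2 o ho h)) ?_
    intro x hx hxr o ho hadj
    by_cases hxA : f x ∈ reach G D O f A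
    · exact hsub o (reach_closed hx hxA ho hadj)
    · have hxe : x ≠ e₁ := by rintro rfl; exact hxA hr
      rw [← hfix x hx hxA] at hxr
      exact reach_closed (Finset.mem_erase.2 ⟨hxe, hx⟩) hxr ho hadj
  have h₂' : e₂ ∈ D.erase e₁ := Finset.mem_erase.2 ⟨hne.symm, h₂⟩
  obtain ⟨g, b, hb, hg, hlg, -⟩ := exists_shift hf' h₂' (hall _ (hf' e₂ h₂').1)
  refine ⟨g, hg, fun o ho => ?_⟩
  have h3 := hlg o
  have h4 := hl o
  have h5 := hf1 o ho
  have h6 : 2 ≤ load (D.erase e₁) f' b := hb.2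
  by_cases hob : o = b
  · subst hob; simp only [if_true] at h3; omega
  · by_cases hoa : o = a
    · subst hoa; simp only [if_true, if_neg hob] at h3 h4; omega
    · simp only [if_neg hob, if_neg hoa] at h3 h4; omega

open Classical in
/-- A surjective assignment together with an integer potential `h` certifying its optimality. -/
theorem exists_assignment_potential [Finite V] (hφ : IsAssignment G D O φ)
    (hφ1 : ∀ o ∈ O, 1 ≤ load D φ o)
    (hacc : ∀ Q ⊆ O, Q.Nonempty →
      (∃ o ∈ Q, 2 ≤ load D φ o) ∨ ∃ e ∈ D, φ e ∉ Q ∧ ∃ o ∈ Q, G.Adj e o)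
    (hfree : ∀ e₁ ∈ D, ∀ e₂ ∈ D, G.Adj e₁ e₂ → ∀ g,
      IsAssignment G ((D.erase e₁).erase e₂) O g →
      ¬ ∀ o ∈ O, 1 ≤ load ((D.erase e₁).erase e₂) g o) :
    ∃ (f : V → V) (h : V → ℕ), IsAssignment G D O f ∧ (∀ o ∈ O, 1 ≤ load D f o) ∧
      (∀ o ∈ O, 1 ≤ h o ∧ h o ≤ load D f o ∧ load D f o ≤ h o + 1) ∧
      (∀ e ∈ D, ∀ o ∈ O, G.Adj e o → h (f e) ≤ h o) ∧
      ∀ e ∈ D, 2 ≤ h (f e) → ∀ v ∈ D, ¬ G.Adj e v := by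
  obtain ⟨f, ⟨hf, hf1⟩, hmin⟩ := Set.exists_min_image
    {g : V → V | IsAssignment G D O g ∧ ∀ o ∈ O, 1 ≤ load D g o}
    (fun g => ∑ o ∈ O, load D g o ^ 2) (Set.toFinite _) ⟨φ, hφ, hφ1⟩
  have hmin' : ∀ g, IsAssignment G D O g → (∀ o ∈ O, 1 ≤ load D g o) →
      ∑ o ∈ O, load D f o ^ 2 ≤ ∑ o ∈ O, load D g o ^ 2 := fun g h1 h2 => hmin g ⟨h1, h2⟩
  let R : ℕ → Set V := fun k => reach G D O f {o | o ∈ O ∧ k + 1 ≤ load D f o}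
  have hR : ∀ k o, o ∈ R k → k ≤ load D f o := fun k o ho =>
    le_load_of_mem_reach hf hf1 hmin' ho
  have hloadD : ∀ o, load D f o ≤ D.card := fun o => Finset.card_filter_le _ _
  have hR1 : ∀ o ∈ O, o ∈ R 1 := mem_of_closed hφ hφ1 hacc hf
    (fun o ho h => subset_reach ⟨ho, h⟩) fun e he h o ho hadj => reach_closed he h ho hadj
  -- Loads are at most `D.card`, so the search bound loses nothing. On `O` the value `k = 1` always
  -- qualifies, so the default 0 does not occur there.
  let h : V → ℕ := fun o => Nat.findGreatest (fun k => o ∈ R k) D.card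
  have hle : ∀ k o, o ∈ R k → k ≤ h o := fun k o ho =>
    Nat.le_findGreatest ((hR k o ho).trans (hloadD o)) ho
  have hmem : ∀ o ∈ O, o ∈ R (h o) := fun o ho =>
    Nat.findGreatest_spec (P := fun k => o ∈ R k) (m := 1)
      ((hR 1 o (hR1 o ho)).trans (hloadD o)) (hR1 o ho)
  refine ⟨f, h, hf, hf1, fun o ho => ⟨hle 1 o (hR1 o ho), hR _ o (hmem o ho), ?_⟩, ?_, ?_⟩
  · have h1 := hf1 o ho
    -- The trivial path: `o` itself is a starting point for `k = load D f o - 1`.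
    have : o ∈ R (load D f o - 1) := subset_reach ⟨ho, by omega⟩
    have := hle _ o this
    omega
  · intro e he o ho hadj
    exact hle _ o (reach_closed he (hmem _ (hf e he).1) ho hadj)
  · intro e he h2 v hv hadj
    obtain ⟨g, hg, hg1⟩ := exists_free_pair hφ hφ1 hacc hf hf1 h2 (hR _) he hv hadj.ne
      (hmem _ (hf e he).1)
    exact hfree e he v hv hadj g hg hg1

end Optimal

/-! ### Minimum edge covers and the structure of a levelling. -/

section Levels

variable {V : Type*} {G F : SimpleGraph V} {L : ℕ → Set V}

theorem deg_pos_of_adj [Finite V] {u v : V} (h : F.Adj u v) : 1 ≤ deg F u :=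
  (Set.ncard_pos (Set.toFinite _)).2 ⟨v, h⟩

theorem eq_of_adj_of_deg_le_one [Finite V] {u v w : V} (hu : deg F u ≤ 1) (hv : F.Adj u v)
    (hw : F.Adj u w) : v = w :=
  (Set.ncard_le_one (Set.toFinite _)).1 hu v hv w hw

theorem IsEdgeCover.exists_adj [Finite V] (hF : IsEdgeCover G F) (v : V) : ∃ u, F.Adj v u :=
  (Set.ncard_pos (Set.toFinite _)).1 (hF.2 v)

theorem isEdgeCover_of_exists_adj [Finite V] (hle : F ≤ G) (h : ∀ v, ∃ u, F.Adj v u) : IsEdgeCover G F :=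
  ⟨hle, fun v => let ⟨_, hu⟩ := h v; deg_pos_of_adj hu⟩

/-- A set of edges of `G` that covers all vertices has at least as many elements as a minimum
edge cover. -/
theorem IsMinimumEdgeCover.ncard_le [Finite V] (hF : IsMinimumEdgeCover G F) (S : Set (Sym2 V))
    (hS : S ⊆ G.edgeSet) (hcov : ∀ v, ∃ u, s(v, u) ∈ S) : F.edgeSet.ncard ≤ S.ncard := by
  refine (hF.2 (SimpleGraph.fromEdgeSet S) (isEdgeCover_of_exists_adj ?_ fun v => ?_)).trans ?_
  · intro u v h
    exact hS ((SimpleGraph.fromEdgeSet_adj _).1 h).1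
  · obtain ⟨u, hu⟩ := hcov v
    have : G.Adj v u := hS hu
    exact ⟨u, (SimpleGraph.fromEdgeSet_adj _).2 ⟨hu, this.ne⟩⟩
  · rw [SimpleGraph.edgeSet_fromEdgeSet]
    exact Set.ncard_le_ncard Set.sdiff_subset (Set.toFinite _)

/-- No edge of a minimum edge cover joins two centers. -/
theorem IsMinimumEdgeCover.not_isCenter_of_adj [Finite V] (hF : IsMinimumEdgeCover G F) {u v : V}
    (h : F.Adj u v) (hu : IsCenter F u) : ¬ IsCenter F v := by
  intro hv
  have hother : ∀ x y, IsCenter F x → ∃ z, F.Adj x z ∧ z ≠ y := fun x y hx => by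
    obtain ⟨z, hz, hzy⟩ := Set.exists_ne_of_one_lt_ncard hx y
    exact ⟨z, hz, hzy⟩
  have hlt : (F.edgeSet \ {s(u, v)}).ncard < F.edgeSet.ncard :=
    Set.ncard_sdiff_singleton_lt_of_mem h (Set.toFinite _)
  refine absurd (hF.ncard_le _ (Set.sdiff_subset.trans (SimpleGraph.edgeSet_mono hF.1.1)) ?_)
    (not_le.2 hlt)
  intro x
  by_cases hxu : x = u
  · subst hxu
    obtain ⟨z, hz, hzv⟩ := hother x v hu
    refine ⟨z, hz, fun h' => ?_⟩
    rcases Sym2.eq_iff.1 h' with ⟨-, h2⟩ | ⟨h1, h2⟩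
    · exact hzv h2
    · exact h.ne h1
  · by_cases hxv : x = v
    · subst hxv
      obtain ⟨z, hz, hzv⟩ := hother x u hv
      refine ⟨z, hz, fun h' => ?_⟩
      rcases Sym2.eq_iff.1 h' with ⟨h1, -⟩ | ⟨h1, h2⟩
      · exact hxu h1
      · exact hzv h2
    · obtain ⟨z, hz⟩ := hF.1.exists_adj x
      refine ⟨z, hz, fun h' => ?_⟩
      rcases Sym2.eq_iff.1 h' with ⟨h1, -⟩ | ⟨h1, -⟩
      · exact hxu h1
      · exact hxv h1

/-- The vertices on even levels. -/
def evenVertices (L : ℕ → Set V) : Set V := {v | ∃ i, Even i ∧ v ∈ L i}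

theorem IsLevelling.notMem_of_le (hL : IsLevelling G F L) {i j : ℕ} (hij : j ≤ i) {v : V}
    (hv : v ∈ L (i + 1)) : v ∉ L j := by
  rcases Nat.even_or_odd i with hi | hi
  · rcases eq_or_ne i 0 with rfl | hi0
    · obtain rfl : j = 0 := by omega
      simp [hL.level_zero]
    · rw [hL.odd_level i hi0 hi] at hv
      exact hv.1 j hij
  · rw [hL.even_level i hi] at hv
    exact hv.1 j hij

theorem IsLevelling.level_unique (hL : IsLevelling G F L) {i j : ℕ} {v : V}
    (hi : v ∈ L i) (hj : v ∈ L j) : i = j := by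
  rcases lt_trichotomy i j with h | h | h
  · obtain ⟨j, rfl⟩ := Nat.exists_eq_add_of_lt h
    exact absurd hi (hL.notMem_of_le (by omega) hj)
  · exact h
  · obtain ⟨j, rfl⟩ := Nat.exists_eq_add_of_lt h
    exact absurd hj (hL.notMem_of_le (by omega) hi)

theorem IsLevelling.deg_le_one (hL : IsLevelling G F L) {v : V} (hv : v ∉ L 1) :
    deg F v ≤ 1 := by
  rw [hL.level_one] at hv
  exact not_lt.1 hv

theorem IsLevelling.exists_adj_of_mem_succ (hL : IsLevelling G F L) {i : ℕ} (hi : Odd i) {v : V}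
    (hv : v ∈ L (i + 1)) : ∃ u ∈ L i, F.Adj v u := by
  rw [hL.even_level i hi] at hv
  obtain ⟨-, u, hu, h⟩ := hv
  exact ⟨u, hu, h.symm⟩

/-- The neighbour in `F` of a vertex on level `i + 1`, `i` odd, is on level `i`. -/
theorem IsLevelling.mem_of_adj_of_mem_succ [Finite V] (hL : IsLevelling G F L) {i : ℕ} (hi : Odd i) {u v : V}
    (hv : v ∈ L (i + 1)) (h : F.Adj v u) : u ∈ L i := by
  obtain ⟨w, hw, hvw⟩ := hL.exists_adj_of_mem_succ hi hv
  have h1 : v ∉ L 1 := fun h1 => by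
    have := hL.level_unique h1 hv
    have := hi.pos
    omega
  rwa [eq_of_adj_of_deg_le_one (hL.deg_le_one h1) h hvw]

/-- The neighbours in `F` of a vertex on an odd level `i` are on level `i + 1`. -/
theorem IsLevelling.mem_succ_of_adj [Finite V] (hL : IsLevelling G F L) (hF : IsMinimumEdgeCover G F)
    {i : ℕ} (hi : Odd i) {u v : V} (hv : v ∈ L i) (h : F.Adj v u) : u ∈ L (i + 1) := by
  rw [hL.even_level i hi]
  -- Suppose `u` were on a level `j ≤ i`. For even `j` its neighbour `v` would be on level `j - 1`;
  -- for odd `j < i`, `v` would be on level `j + 1` or lower. For `j = i`, either two centers are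
  -- adjacent (`i = 1`) or the rule for odd levels is violated.
  refine ⟨fun j hj huj => ?_, v, hv, h⟩
  rcases Nat.even_or_odd j with hje | hjo
  · obtain _ | j := j
    · simp [hL.level_zero] at huj
    · have hjo : Odd j := by simpa [Nat.even_add_one] using hje
      have := hL.mem_of_adj_of_mem_succ hjo huj h.symm
      have := hL.level_unique this hv
      omega
  · rcases hj.lt_or_eq with hlt | rfl
    · have hvj : v ∉ L (j + 1) := fun h' => by
        have := hL.level_unique h' hv
        subst this
        exact (Nat.not_even_iff_odd.2 hi) hjo.add_one
      rw [hL.even_level j hjo] at hvj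
      refine hvj ⟨fun k hk hvk => ?_, u, huj, h.symm⟩
      have := hL.level_unique hvk hv
      omega
    · obtain _ | i := j
      · simp [hL.level_zero] at huj
      · have hie : Even i := by
          rcases Nat.even_or_odd i with h' | h'
          · exact h'
          · exact absurd hi (Nat.not_odd_iff_even.2 h'.add_one)
        rcases eq_or_ne i 0 with rfl | hi0
        · simp only [zero_add, hL.level_one] at huj hv
          exact hF.not_isCenter_of_adj h hv huj
        · rw [hL.odd_level i hi0 hie] at hv
          exact hv.2.2 u huj h.symm

theorem IsLevelling.evenVertices_of_adj [Finite V] (hL : IsLevelling G F L) (hF : IsMinimumEdgeCover G F)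
    {u v : V} (hv : v ∈ oddVertices L) (h : F.Adj v u) : u ∈ evenVertices L := by
  obtain ⟨i, hi, hv⟩ := hv
  exact ⟨i + 1, hi.add_one, hL.mem_succ_of_adj hF hi hv h⟩

theorem IsLevelling.exists_eq_succ (hL : IsLevelling G F L) {v : V} (hv : v ∈ evenVertices L) :
    ∃ i, Odd i ∧ v ∈ L (i + 1) := by
  obtain ⟨i, hi, hv⟩ := hv
  obtain _ | i := i
  · simp [hL.level_zero] at hv
  · exact ⟨i, by simpa [Nat.even_add_one] using hi, hv⟩

theorem IsLevelling.oddVertices_of_adj [Finite V] (hL : IsLevelling G F L)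
    {u v : V} (hv : v ∈ evenVertices L) (h : F.Adj v u) : u ∈ oddVertices L := by
  obtain ⟨i, hi, hv⟩ := hL.exists_eq_succ hv
  exact ⟨i, hi, hL.mem_of_adj_of_mem_succ hi hv h⟩

theorem IsLevelling.notMem_oddVertices (hL : IsLevelling G F L)
    {v : V} (hv : v ∈ evenVertices L) : v ∉ oddVertices L := by
  rintro ⟨j, hj, hvj⟩
  obtain ⟨i, hi, hvi⟩ := hv
  rw [hL.level_unique hvi hvj] at hi
  exact (Nat.not_even_iff_odd.2 hj) hi

theorem mem_unlevelled_iff {v : V} :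
    v ∈ unlevelled L ↔ v ∉ oddVertices L ∧ v ∉ evenVertices L := by
  constructor
  · intro h
    exact ⟨fun ⟨i, _, hi⟩ => h i hi, fun ⟨i, _, hi⟩ => h i hi⟩
  · rintro ⟨h1, h2⟩ i hi
    rcases Nat.even_or_odd i with h | h
    · exact h2 ⟨i, h, hi⟩
    · exact h1 ⟨i, h, hi⟩

theorem IsLevelling.unlevelled_of_adj [Finite V] (hL : IsLevelling G F L) (hF : IsMinimumEdgeCover G F)
    {u v : V} (hv : v ∈ unlevelled L) (h : F.Adj v u) : u ∈ unlevelled L := by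
  rw [mem_unlevelled_iff] at *
  exact ⟨fun h' => hv.2 (hL.evenVertices_of_adj hF h' h.symm),
    fun h' => hv.1 (hL.oddVertices_of_adj h' h.symm)⟩

theorem IsLevelling.deg_le_one_of_notMem (hL : IsLevelling G F L) {v : V}
    (hv : v ∉ oddVertices L) : deg F v ≤ 1 :=
  hL.deg_le_one fun h => hv ⟨1, odd_one, h⟩

/-- No edge of `G` joins a vertex on an even level to a vertex without a level. -/
theorem IsLevelling.not_adj_of_unlevelled [Finite V] (hL : IsLevelling G F L) (hF : IsMinimumEdgeCover G F)
    {u v : V} (hv : v ∈ evenVertices L) (hu : u ∈ unlevelled L) : ¬ G.Adj v u := by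
  intro hadj
  by_cases hFadj : F.Adj v u
  · exact (mem_unlevelled_iff.1 hu).1 (hL.oddVertices_of_adj hv hFadj)
  · obtain ⟨i, hi, hv⟩ := hL.exists_eq_succ hv
    have hnot := hu (i + 1 + 1)
    rw [hL.odd_level (i + 1) (by omega) hi.add_one] at hnot
    -- Only an `F`-neighbour `w` on that odd level could keep `u` off it, but then `u` would be on
    -- an even level.
    refine hnot ⟨fun j _ => hu j, ⟨v, hv, hadj, hFadj⟩, fun w hw hwu => ?_⟩
    exact (mem_unlevelled_iff.1 hu).2
      (hL.evenVertices_of_adj hF ⟨i + 1 + 1, hi.add_one.add_one, hw⟩ hwu)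

/-- A nonempty set `Q` of vertices on odd levels contains a center, or it is adjacent to a vertex
on an even level whose neighbour in `F` is outside `Q`. -/
theorem IsLevelling.isCenter_or_exists_adj [Finite V] (hL : IsLevelling G F L) {Q : Set V}
    (hQ : Q ⊆ oddVertices L) (hne : Q.Nonempty) :
    (∃ o ∈ Q, IsCenter F o) ∨
      ∃ e ∈ evenVertices L, (∀ u, F.Adj e u → u ∉ Q) ∧ ∃ o ∈ Q, G.Adj e o := by
  classical
  -- Take the lowest level that meets `Q`. Above level 1, the vertex that caused `o` to be placed
  -- there has its `F`-neighbour two levels below `o`, hence outside `Q`.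
  have hex : ∃ i, Odd i ∧ ∃ o ∈ Q, o ∈ L i := by
    obtain ⟨o, ho⟩ := hne
    obtain ⟨i, hi, hoi⟩ := hQ ho
    exact ⟨i, hi, o, ho, hoi⟩
  obtain ⟨hodd, o, ho, hoi⟩ := Nat.find_spec hex
  have hmin := fun j => Nat.find_min hex (m := j)
  generalize Nat.find hex = n at *
  obtain _ | _ | i := n
  · simp [hL.level_zero] at hoi
  · rw [zero_add, hL.level_one] at hoi
    exact Or.inl ⟨o, ho, hoi⟩
  · have hi : Odd i := by
      rcases Nat.even_or_odd i with h' | h'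
      · exact absurd hodd (Nat.not_odd_iff_even.2 h'.add_one.add_one)
      · exact h'
    rw [hL.odd_level (i + 1) (by omega) hi.add_one] at hoi
    obtain ⟨-, ⟨e, he, hadj, -⟩, -⟩ := hoi
    refine Or.inr ⟨e, ⟨i + 1, hi.add_one, he⟩, fun u hu huQ => ?_, o, ho, hadj⟩
    exact hmin i (by omega) ⟨hi, u, huQ, hL.mem_of_adj_of_mem_succ hi he hu⟩

end Levels

/-! ### Degree sums and convexity of the cost. -/

section Degree

variable {V : Type*} [Fintype V]

theorem sum_deg (F : SimpleGraph V) : ∑ v, deg F v = 2 * F.edgeSet.ncard := by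
  classical
  have h : ∀ v, deg F v = F.degree v := fun v => by
    rw [deg, Set.ncard_eq_toFinset_card', SimpleGraph.degree, SimpleGraph.neighborFinset]
  rw [Finset.sum_congr rfl fun v _ => h v, F.sum_degrees_eq_twice_card_edges,
    Set.ncard_eq_toFinset_card', SimpleGraph.edgeFinset]

theorem two_mul_cost (F : SimpleGraph V) : 2 * cost F = ∑ v, deg F v * (deg F v + 1) := by
  rw [cost, Finset.mul_sum]
  exact Finset.sum_congr rfl fun v _ =>
    Nat.mul_div_cancel' (Nat.even_mul_succ_self _).two_dvd

/-- If `q v + 2` is a subgradient at `deg X v` of the cost of `v`, and `X` does not exceed `F` in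
the sum of the degrees weighted by `q + 2`, then `X` does not cost more than `F`. -/
theorem cost_le_of_sum_le {X F : SimpleGraph V} (q : V → ℕ)
    (hq : ∀ v, q v + 2 = deg X v ∨ q v + 2 = deg X v + 1)
    (hsum : ∑ v, (q v + 2) * deg X v ≤ ∑ v, (q v + 2) * deg F v) : cost X ≤ cost F := by
  have hv : ∀ v, (deg X v : ℤ) * (deg X v + 1) + 2 * ((q v + 2) * deg F v) ≤
      (deg F v : ℤ) * (deg F v + 1) + 2 * ((q v + 2) * deg X v) := by
    intro v
    -- With `t = deg F v - deg X v`, the difference of the two sides is `t (t + 1)` or `t (t - 1)`,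
    -- nonnegative for integers.
    obtain h | h | h : (deg F v : ℤ) = deg X v ∨ (deg F v : ℤ) + 1 ≤ deg X v ∨
        (deg X v : ℤ) + 1 ≤ deg F v := by omega
    · rw [h]
    all_goals
      obtain h2 | h2 := hq v
      · have : (q v : ℤ) + 2 = deg X v := by exact_mod_cast h2
        rw [this]
        nlinarith
      · have : (q v : ℤ) + 2 = deg X v + 1 := by exact_mod_cast h2
        rw [this]
        nlinarith
  have htot := Finset.sum_le_sum fun v (_ : v ∈ Finset.univ) => hv v
  simp only [Finset.sum_add_distrib, ← Finset.mul_sum] at htot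
  have h1 := two_mul_cost X
  have h2 := two_mul_cost F
  zify at h1 h2 hsum ⊢
  linarith

end Degree

/-! ### Star forests with prescribed centers. -/

section Star

variable {V : Type*}

/-- The graph that joins every vertex outside `C` to its image under `g`. -/
def starForest (C : Set V) (g : V → V) : SimpleGraph V :=
  SimpleGraph.fromRel fun a b => a ∉ C ∧ g a = b

variable {C : Set V} {g : V → V}

theorem starForest_adj_of_notMem (hg : ∀ a ∉ C, g a ∈ C) {a b : V} (ha : a ∉ C) :
    (starForest C g).Adj a b ↔ b = g a := by
  rw [starForest, SimpleGraph.fromRel_adj]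
  constructor
  · rintro ⟨-, ⟨-, h⟩ | ⟨hb, rfl⟩⟩
    · exact h.symm
    · exact absurd (hg b hb) ha
  · rintro rfl
    exact ⟨fun h => ha (h ▸ hg a ha), Or.inl ⟨ha, rfl⟩⟩

theorem starForest_adj_of_mem {c b : V} (hc : c ∈ C) :
    (starForest C g).Adj c b ↔ b ∉ C ∧ g b = c := by
  rw [starForest, SimpleGraph.fromRel_adj]
  constructor
  · rintro ⟨-, ⟨h, -⟩ | h⟩
    · exact absurd hc h
    · exact h
  · intro h
    exact ⟨fun h' => h.1 (h' ▸ hc), Or.inr h⟩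

theorem deg_starForest_of_notMem (hg : ∀ a ∉ C, g a ∈ C) {a : V} (ha : a ∉ C) :
    deg (starForest C g) a = 1 := by
  refine Set.ncard_eq_one.2 ⟨g a, ?_⟩
  ext b
  exact starForest_adj_of_notMem hg ha

theorem deg_starForest_of_mem {c : V} (hc : c ∈ C) :
    deg (starForest C g) c = {b | b ∉ C ∧ g b = c}.ncard := by
  rw [deg]
  congr 1
  ext b
  exact starForest_adj_of_mem hc

theorem edgeSet_starForest_subset : (starForest C g).edgeSet ⊆ (fun a => s(a, g a)) '' Cᶜ := by
  intro e
  induction e with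
  | _ a b =>
    intro h
    rw [SimpleGraph.mem_edgeSet, starForest, SimpleGraph.fromRel_adj] at h
    obtain ⟨-, ⟨h, rfl⟩ | ⟨h, rfl⟩⟩ := h
    · exact ⟨a, h, rfl⟩
    · exact ⟨b, h, Sym2.eq_swap⟩

theorem isExtendedSetOfCenters_starForest (hg : ∀ a ∉ C, g a ∈ C) :
    IsExtendedSetOfCenters (starForest C g) C := by
  classical
  constructor
  · intro v hv
    by_contra h
    rw [IsCenter, deg_starForest_of_notMem hg h] at hv
    exact lt_irrefl _ hv
  -- The retraction onto `C` is constant on components and fixes `C`, so a component cannot contain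
  -- two vertices of `C`.
  · let r : V → V := fun v => if v ∈ C then v else g v
    have hadj : ∀ a b, (starForest C g).Adj a b → r a = r b := by
      intro a b h
      by_cases ha : a ∈ C
      · obtain ⟨hb, hab⟩ := (starForest_adj_of_mem ha).1 h
        simp only [r, if_pos ha, if_neg hb, hab]
      · rw [starForest_adj_of_notMem hg ha] at h
        subst h
        simp only [r, if_neg ha, if_pos (hg a ha)]
    have hreach : ∀ a b, (starForest C g).Reachable a b → r a = r b := by
      rintro a b ⟨p⟩
      induction p with
      | nil => rfl
      | cons h _ ih => exact (hadj _ _ h).trans ih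
    intro K
    induction K using SimpleGraph.ConnectedComponent.ind with
    | h v =>
    have hr : ∀ c, c ∈ C → r c = c := fun c hc => if_pos hc
    refine ⟨r v, ⟨?_, ?_⟩, ?_⟩
    · by_cases hv : v ∈ C
      · rwa [hr v hv]
      · simpa only [r, if_neg hv] using hg v hv
    · rw [SimpleGraph.ConnectedComponent.mem_supp_iff, SimpleGraph.ConnectedComponent.eq]
      by_cases hv : v ∈ C
      · rw [hr v hv]
      · have : (starForest C g).Adj v (r v) := by
          rw [starForest_adj_of_notMem hg hv]
          exact if_neg hv
        exact this.reachable.symm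
    · rintro c ⟨hc, hcK⟩
      rw [SimpleGraph.ConnectedComponent.mem_supp_iff, SimpleGraph.ConnectedComponent.eq] at hcK
      rw [← hreach _ _ hcK, hr c hc]

end Star

/-! ### Double counting of weighted degrees. -/

section Weights

variable {V : Type*}

theorem sum_mul_load {D O : Finset V} {f : V → V} (hf : ∀ x ∈ D, f x ∈ O) (q : V → ℕ) :
    ∑ o ∈ O, q o * load D f o = ∑ e ∈ D, q (f e) := by
  classical
  rw [← Finset.sum_fiberwise_of_maps_to hf]
  refine Finset.sum_congr rfl fun o _ => ?_
  rw [Finset.sum_congr rfl fun x hx => by rw [(Finset.mem_filter.1 hx).2], Finset.sum_const, load,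
    smul_eq_mul, mul_comm]

/-- The right side sums `q v` over all ordered adjacent pairs `(e, v)`; each `e` in `D` already pays
`a e` through its pair with `w`. -/
theorem sum_le_sum_mul_deg [Fintype V] (F : SimpleGraph V) (D : Finset V) (a q : V → ℕ)
    (h : ∀ e ∈ D, ∃ w, F.Adj e w ∧ a e ≤ q w) : ∑ e ∈ D, a e ≤ ∑ v, q v * deg F v := by
  classical
  have hdeg : ∀ v, q v * deg F v = ∑ e, if F.Adj e v then q v else 0 := fun v => by
    rw [deg, Set.ncard_eq_toFinset_card', ← Finset.sum_filter, Finset.sum_const, smul_eq_mul,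
      mul_comm]
    congr 2
    ext e
    simp [F.adj_comm]
  simp only [hdeg]
  rw [Finset.sum_comm]
  calc ∑ e ∈ D, a e ≤ ∑ e ∈ D, ∑ v, (if F.Adj e v then q v else 0) := by
        refine Finset.sum_le_sum fun e he => ?_
        obtain ⟨w, hw, hle⟩ := h e he
        refine hle.trans ?_
        have := Finset.single_le_sum (f := fun v => if F.Adj e v then q v else 0)
          (fun v _ => Nat.zero_le _) (Finset.mem_univ w)
        simpa only [if_pos hw] using this
    _ ≤ ∑ e, ∑ v, (if F.Adj e v then q v else 0) :=
        Finset.sum_le_sum_of_subset (Finset.subset_univ D)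

end Weights

/-! ### Construction of the cover and proof of its optimality. -/

/-- A set produced by Find-Center is an extended set of centers of some optimal balanced edge
cover. -/
theorem IsFindCenterSet.exists_isOptimalBalancedEdgeCover {V : Type*} [Fintype V] (G F : SimpleGraph V) (C : Set V)
    (hC : IsFindCenterSet G F C) :
    ∃ Fstar : SimpleGraph V, IsOptimalBalancedEdgeCover G Fstar ∧
      IsExtendedSetOfCenters Fstar C := by
  classical
  obtain ⟨hF, L, T, hL, hTU, hT, rfl⟩ := hC
  choose φ hφ using hF.1.exists_adj
  have hφG : ∀ v, G.Adj v (φ v) := fun v => hF.1.1 (hφ v)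
  set C := oddVertices L ∪ T
  let E : Finset V := Finset.univ.filter (· ∈ evenVertices L)
  let O : Finset V := Finset.univ.filter (· ∈ oddVertices L)
  have memE : ∀ v, v ∈ E ↔ v ∈ evenVertices L := fun v => by simp [E]
  have memO : ∀ v, v ∈ O ↔ v ∈ oddVertices L := fun v => by simp [O]
  have hTodd : ∀ v ∈ T, v ∉ oddVertices L := fun v hv => (mem_unlevelled_iff.1 (hTU hv)).1
  have hE_C : ∀ v ∈ E, v ∉ C := by
    rintro v hv (h | h)
    · exact hL.notMem_oddVertices ((memE v).1 hv) h
    · exact (mem_unlevelled_iff.1 (hTU h)).2 ((memE v).1 hv)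
  have hU : ∀ v ∉ C, v ∉ E → v ∈ unlevelled L := fun v hv hvE =>
    mem_unlevelled_iff.2 ⟨fun h => hv (Or.inl h), fun h => hvE ((memE v).2 h)⟩
  have hφφ : ∀ v u, u ∉ oddVertices L → F.Adj v u → φ u = v := fun v u hu h =>
    eq_of_adj_of_deg_le_one (hL.deg_le_one_of_notMem hu) (hφ u) h.symm
  have hφE : ∀ v ∈ E, φ v ∈ O := fun v hv =>
    (memO _).2 (hL.oddVertices_of_adj ((memE v).1 hv) (hφ v))
  have hφT : ∀ v ∉ C, v ∉ E → φ v ∈ T := fun v hv hvE => by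
    by_contra h
    exact hv (Or.inr ((hT v (hU v hv hvE) _ (hL.unlevelled_of_adj hF (hU v hv hvE) (hφ v))
      (hφ v)).2 h))
  have hTφ : ∀ t ∈ T, φ t ∉ C ∧ φ t ∉ E ∧ φ (φ t) = t := fun t ht => by
    have h1 := hL.unlevelled_of_adj hF (hTU ht) (hφ t)
    have h2 := mem_unlevelled_iff.1 h1
    refine ⟨?_, fun h => h2.2 ((memE _).1 h), hφφ _ _ h2.1 (hφ t)⟩
    rintro (h | h)
    · exact h2.1 h
    · exact (hT t (hTU ht) _ h1 (hφ t)).1 ht h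
  have hφC : ∀ v ∉ C, φ v ∈ C := fun v hv => by
    by_cases hvE : v ∈ E
    · exact Or.inl ((memO _).1 (hφE v hvE))
    · exact Or.inr (hφT v hv hvE)
  -- Each vertex outside `C` owns its edge of `F`, since the other endpoint is in `C`.
  have hcard : (Cᶜ).ncard ≤ F.edgeSet.ncard := by
    refine Set.ncard_le_ncard_of_injOn (fun v => s(v, φ v)) (fun v _ => hφ v) ?_
    intro x hx y hy hxy
    rcases Sym2.eq_iff.1 hxy with ⟨h, -⟩ | ⟨h, -⟩
    · exact h
    · exact absurd (h ▸ hφC y hy) hx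
  -- The map that assigns `E` by `f` and the other vertices outside `C` by `φ`.
  let ext : (V → V) → V → V := fun f x => if x ∈ E then f x else φ x
  have ext_E : ∀ f, ∀ x ∈ E, ext f x = f x := fun f x hx => if_pos hx
  have ext_U : ∀ f x, x ∉ E → ext f x = φ x := fun f x hx => if_neg hx
  have hassign : IsAssignment G E O φ := fun x hx => ⟨hφE x hx, hφG x⟩
  have hodd : ∀ o ∈ O, ∀ x, F.Adj o x → x ∈ E ∧ φ x = o := fun o ho x hx => by
    have h := hL.evenVertices_of_adj hF ((memO o).1 ho) hx
    exact ⟨(memE x).2 h, hφφ _ _ (hL.notMem_oddVertices h) hx⟩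
  have hφ1 : ∀ o ∈ O, 1 ≤ load E φ o := fun o ho => by
    obtain ⟨h1, h2⟩ := hodd o ho (φ o) (hφ o)
    exact Finset.card_pos.2 ⟨φ o, Finset.mem_filter.2 ⟨h1, h2⟩⟩
  obtain ⟨f, h, hf, hf1, hh, hmono, hind⟩ := exists_assignment_potential hassign hφ1
    (by
      intro Q hQ hne
      rcases hL.isCenter_or_exists_adj (Q := Q) (fun o ho => (memO o).1 (hQ ho)) hne with
        ⟨o, ho, hc⟩ | ⟨e, he, heQ, o, ho, hadj⟩
      · left
        refine ⟨o, ho, ?_⟩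
        obtain ⟨a, b, ha, hb, hab⟩ := (Set.one_lt_ncard_iff (Set.toFinite _)).1 hc
        obtain ⟨h1, h2⟩ := hodd o (hQ ho) a ha
        obtain ⟨h3, h4⟩ := hodd o (hQ ho) b hb
        exact Finset.one_lt_card.2 ⟨a, Finset.mem_filter.2 ⟨h1, h2⟩, b,
          Finset.mem_filter.2 ⟨h3, h4⟩, hab⟩
      · right
        exact ⟨e, (memE e).2 he, fun h' => heQ _ (hφ e) h', o, ho, hadj⟩)
    (by
      intro e₁ h₁ e₂ h₂ hadj g hg hg1
      let W : Set V := Cᶜ \ {e₁, e₂}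
      have hne := hadj.ne
      have hW : W.ncard + 2 = (Cᶜ).ncard := by
        rw [← Set.ncard_pair hne]
        refine Set.ncard_sdiff_add_ncard_of_subset ?_
        rintro x (rfl | rfl)
        · exact hE_C _ h₁
        · exact hE_C _ h₂
      have hgW : ∀ x ∈ W, x ∈ E → x ∈ (E.erase e₁).erase e₂ := fun x hx hxE =>
        Finset.mem_erase.2 ⟨fun h' => hx.2 (Or.inr h'), Finset.mem_erase.2
          ⟨fun h' => hx.2 (Or.inl h'), hxE⟩⟩
      -- One edge covers both `e₁` and `e₂`, and every other vertex outside `C` uses one edge. This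
      -- cover has at most `(Cᶜ).ncard - 1` edges, fewer than `F`.
      have hle := hF.ncard_le (insert s(e₁, e₂) ((fun x => s(x, ext g x)) '' W)) (by
          rintro _ (rfl | ⟨x, hx, rfl⟩)
          · exact hadj
          · change G.Adj x (ext g x)
            by_cases hxE : x ∈ E
            · rw [ext_E g x hxE]
              exact (hg x (hgW x hx hxE)).2
            · rw [ext_U g x hxE]
              exact hφG x) (by
          intro v
          by_cases hv₁ : v = e₁
          · exact ⟨e₂, Or.inl (by rw [hv₁])⟩
          by_cases hv₂ : v = e₂
          · exact ⟨e₁, Or.inl (by rw [hv₂, Sym2.eq_swap])⟩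
          by_cases hvC : v ∈ C
          · obtain ⟨x, hx, hxv⟩ : ∃ x ∈ W, ext g x = v := by
              rcases hvC with hv | hv
              · obtain ⟨x, hx⟩ := Finset.card_pos.1 (hg1 v ((memO v).2 hv))
                obtain ⟨hx, hxv⟩ := Finset.mem_filter.1 hx
                obtain ⟨hx₂, hx⟩ := Finset.mem_erase.1 hx
                obtain ⟨hx₁, hx⟩ := Finset.mem_erase.1 hx
                exact ⟨x, ⟨hE_C x hx, by rintro (h' | h') <;> contradiction⟩,
                  (ext_E g x hx).trans hxv⟩
              · obtain ⟨h1, h2, h3⟩ := hTφ v hv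
                refine ⟨φ v, ⟨h1, ?_⟩, (ext_U g _ h2).trans h3⟩
                rintro (h' | h')
                · exact h2 (h' ▸ h₁)
                · exact h2 (h' ▸ h₂)
            exact ⟨x, Or.inr ⟨x, hx, by rw [← hxv]; exact Sym2.eq_swap⟩⟩
          · exact ⟨ext g v, Or.inr ⟨v, ⟨hvC, by rintro (h' | h') <;> contradiction⟩, rfl⟩⟩)
      have h1 := Set.ncard_insert_le s(e₁, e₂) ((fun x => s(x, ext g x)) '' W)
      have h2 : ((fun x => s(x, ext g x)) '' W).ncard ≤ W.ncard :=
        Set.ncard_image_le (Set.toFinite _)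
      omega)
  have hgC : ∀ a ∉ C, ext f a ∈ C := fun a ha => by
    by_cases haE : a ∈ E
    · rw [ext_E f a haE]
      exact Or.inl ((memO _).1 (hf a haE).1)
    · rw [ext_U f a haE]
      exact hφC a ha
  have hgG : ∀ a, G.Adj a (ext f a) := fun a => by
    by_cases haE : a ∈ E
    · rw [ext_E f a haE]
      exact (hf a haE).2
    · rw [ext_U f a haE]
      exact hφG a
  have hdegO : ∀ o ∈ O, deg (starForest C (ext f)) o = load E f o := fun o ho => by
    rw [deg_starForest_of_mem (C := C) (Or.inl ((memO o).1 ho)), load, ← Set.ncard_coe_finset]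
    congr 1
    ext b
    simp only [Set.mem_ofPred_eq, Finset.coe_filter]
    constructor
    · rintro ⟨hb, hbo⟩
      by_cases hbE : b ∈ E
      · exact ⟨hbE, by rw [← hbo, ext_E f b hbE]⟩
      · rw [ext_U f b hbE] at hbo
        exact absurd ((memO o).1 ho) (hTodd o (hbo ▸ hφT b hb hbE))
    · rintro ⟨hbE, hbo⟩
      exact ⟨hE_C b hbE, by rw [ext_E f b hbE, hbo]⟩
  have hdeg1 : ∀ v ∉ O, deg (starForest C (ext f)) v = 1 := fun v hv => by
    by_cases hvC : v ∈ C
    · have hvT : v ∈ T := hvC.resolve_left fun h' => hv ((memO v).2 h')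
      obtain ⟨h1, h2, h3⟩ := hTφ v hvT
      rw [deg_starForest_of_mem hvC]
      refine Set.ncard_eq_one.2 ⟨φ v, ?_⟩
      ext b
      simp only [Set.mem_ofPred_eq, Set.mem_singleton_iff]
      constructor
      · rintro ⟨hb, hbv⟩
        have hbE : b ∉ E := fun hbE => hv (by
          rw [← hbv, ext_E f b hbE]
          exact (hf b hbE).1)
        rw [ext_U f b hbE] at hbv
        exact (hφφ b v (hTodd v hvT) (hbv ▸ hφ b)).symm
      · rintro rfl
        exact ⟨h1, (ext_U f _ h2).trans h3⟩
    · exact deg_starForest_of_notMem hgC hvC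
  have hedges : (starForest C (ext f)).edgeSet.ncard ≤ F.edgeSet.ncard :=
    ((Set.ncard_le_ncard edgeSet_starForest_subset (Set.toFinite _)).trans
      (Set.ncard_image_le (Set.toFinite _))).trans hcard
  refine ⟨starForest C (ext f), ⟨⟨?_, fun v => ?_⟩, fun F' hF' => ?_⟩,
    isExtendedSetOfCenters_starForest hgC⟩
  · intro a b hab
    by_cases ha : a ∈ C
    · obtain ⟨-, rfl⟩ := (starForest_adj_of_mem ha).1 hab
      exact (hgG b).symm
    · rw [starForest_adj_of_notMem hgC ha] at hab
      exact hab ▸ hgG a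
  · by_cases hv : v ∈ O
    · rw [hdegO v hv]
      exact hf1 v hv
    · rw [hdeg1 v hv]
  -- On `O` the weight `q + 2` is `h + 1`, which is the load or the load plus one. Elsewhere it is
  -- 2, one more than the degree 1.
  · let q : V → ℕ := fun v => if v ∈ O then h v - 1 else 0
    have hqO : ∀ o ∈ O, q o = h o - 1 := fun o ho => if_pos ho
    have hqO' : ∀ o ∉ O, q o = 0 := fun o ho => if_neg ho
    refine cost_le_of_sum_le q (fun v => ?_) ?_
    · by_cases hv : v ∈ O
      · have := hh v hv
        rw [hdegO v hv, hqO v hv]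
        omega
      · rw [hdeg1 v hv, hqO' v hv]
        exact Or.inr rfl
    · simp only [add_mul, Finset.sum_add_distrib, ← Finset.mul_sum]
      -- The `q`-part is compared through the potential, the constant part 2 through the numbers of
      -- edges.
      refine add_le_add ?_ ?_
      · have h1 : ∑ v, q v * deg (starForest C (ext f)) v = ∑ o ∈ O, q o * load E f o := by
          rw [← Finset.sum_subset (Finset.subset_univ O) fun v _ hv => by
            rw [hqO' v hv, zero_mul]]
          exact Finset.sum_congr rfl fun o ho => by rw [hdegO o ho]
        rw [h1, sum_mul_load fun x hx => (hf x hx).1]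
        refine sum_le_sum_mul_deg F' E (fun e => q (f e)) q fun e he => ?_
        obtain ⟨w, hw⟩ := hF'.exists_adj e
        refine ⟨w, hw, ?_⟩
        have hfe := (hf e he).1
        rw [hqO _ hfe]
        -- If `h (f e) ≤ 1`, the weight to be beaten is zero. Otherwise `w` can be neither on an
        -- even level nor unlevelled.
        by_cases h2 : 2 ≤ h (f e)
        · have hwO : w ∈ O := by
            by_contra hwO
            have hwE : w ∉ E := fun hwE => hind e he h2 w hwE (hF'.1 hw)
            exact hL.not_adj_of_unlevelled hF ((memE e).1 he)
              (mem_unlevelled_iff.2 ⟨fun h' => hwO ((memO w).2 h'),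
                fun h' => hwE ((memE w).2 h')⟩) (hF'.1 hw)
          rw [hqO w hwO]
          exact Nat.sub_le_sub_right (hmono e he w hwO (hF'.1 hw)) 1
        · omega
      · rw [sum_deg, sum_deg]
        have := hF.2 F' hF'
        omega

end BalancedEdgeCover

theorem mainTheorem5 {V : Type*} [Fintype V] (G F : SimpleGraph V) (C : Set V)
    (hC : BalancedEdgeCover.IsFindCenterSet G F C) :
    ∃ Fstar : SimpleGraph V, BalancedEdgeCover.IsOptimalBalancedEdgeCover G Fstar ∧
      BalancedEdgeCover.IsExtendedSetOfCenters Fstar C :=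
  hC.exists_isOptimalBalancedEdgeCover
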